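/- Let $p$ be a prime, let $G$ be a compact $p$-adic analytic group (a compact topological group that carries a finite-dimensional analytic manifold structure over $\mathbb{Q}_p$, compatible with its topology, for which multiplication and inversion are analytic), and let $k$ be a commutative ring of characteristic $m>0$. Let $V$ be a smooth representation of $G$ on a $k$-module, i.e. a $k$-linear representation for which the action map $G\times V\to V$ is continuous when $V$ carries the discrete topology. Then every $1$-cocycle $\chi\colon G\to V$ (a map with $\chi(gh)=\chi(g)+g\chi(h)$ for all $g,h\in G$, with no continuity assumed) is continuous for the discrete topology on $V$. Moreover, let $H^1_{\mathrm{abs}}(G,V)$ be the first cohomology group of $G$ as an abstract group, computed by the complex of all inhomogeneous cochains $G^n\to V$, and let $H^1_{\mathrm{cont}}(G,V)$ be the first cohomology group of the subcomplex of continuous inhomogeneous cochains, where $V$ is discrete. Then the comparison map $\varphi^1\colon H^1_{\mathrm{cont}}(G,V)\to H^1_{\mathrm{abs}}(G,V)$ induced by the inclusion of complexes is an isomorphism of $k$-modules. -/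

import Mathlib

open scoped Manifold ContDiff

universe u

/-- A topological group `G` is `p`-adic analytic if it carries the structure of a (finite
dimensional) analytic manifold over `ℚ_[p]`, compatible with its topology, for which multiplication
and inversion are analytic. -/
def IsPAdicAnalyticGroup (p : ℕ) [Fact p.Prime] (G : Type u) [Group G] [TopologicalSpace G] :
    Prop :=
  ∃ (d : ℕ) (_ : ChartedSpace (Fin d → ℚ_[p]) G), LieGroup 𝓘(ℚ_[p], Fin d → ℚ_[p]) ω G

namespace SmoothRep

open CategoryTheory

section Basic

variable {k G : Type u} [CommRing k] [Group G] [TopologicalSpace G]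

/-- A representation `V` of a topological group `G` is smooth if the action map `G × V → V` is
continuous, where `V` carries the discrete topology. -/
def IsSmooth (V : Rep.{u} k G) : Prop :=
  letI : TopologicalSpace V := ⊥
  Continuous fun x : G × V => V.ρ x.1 x.2

/-- Continuity of a map from a topological space to `V`, where `V` carries the discrete topology. -/
def IsCont {X : Type u} [TopologicalSpace X] (V : Rep.{u} k G) (f : X → V) : Prop :=
  letI : TopologicalSpace V := ⊥
  Continuous f

/-- The `k`-module of continuous maps `G ^ n → V`, where `V` carries the discrete topology. -/
def contCochain (V : Rep.{u} k G) (n : ℕ) : Submodule k ((Fin n → G) → V) where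
  carrier := {f | IsCont V f}
  zero_mem' := by
    let _ : TopologicalSpace V := ⊥
    exact continuous_const (y := (0 : V))
  add_mem' {f g} hf hg := by
    let _ : TopologicalSpace V := ⊥
    have : DiscreteTopology V := ⟨rfl⟩
    exact Continuous.add (f := f) (g := g) hf hg
  smul_mem' c f hf := by
    let _ : TopologicalSpace V := ⊥
    have : DiscreteTopology V := ⟨rfl⟩
    exact (continuous_of_discreteTopology (f := fun v : V => c • v)).comp
      (show Continuous f from hf)

theorem continuous_contractNth [IsTopologicalGroup G] {n : ℕ} (j : Fin (n + 1)) :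
    Continuous fun g : Fin (n + 1) → G => Fin.contractNth j (· * ·) g := by
  refine continuous_pi fun i => ?_
  unfold Fin.contractNth
  split_ifs <;> fun_prop

/-- For smooth `V`, the differential of the inhomogeneous cochain complex preserves continuity. -/
theorem d_mem_contCochain [IsTopologicalGroup G] {V : Rep.{u} k G} (hV : IsSmooth V) (n : ℕ)
    {f : (Fin n → G) → V} (hf : f ∈ contCochain V n) :
    (inhomogeneousCochains.d V n).hom f ∈ contCochain V (n + 1) := by
  let _ : TopologicalSpace V := ⊥
  have : DiscreteTopology V := ⟨rfl⟩
  have hf' : Continuous f := hf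
  have hV' : Continuous fun x : G × V => V.ρ x.1 x.2 := hV
  show Continuous fun g : Fin (n + 1) → G => (inhomogeneousCochains.d V n).hom f g
  simp only [inhomogeneousCochains.d_hom_apply]
  refine Continuous.add ?_ (continuous_finsetSum _ fun j _ => ?_)
  · exact hV'.comp (f := fun g : Fin (n + 1) → G => (g 0, f fun i => g i.succ)) (by fun_prop)
  · exact (continuous_of_discreteTopology (f := fun v : V => (-1 : k) ^ ((j : ℕ) + 1) • v)).comp
      (hf'.comp (continuous_contractNth j))

end Basic

noncomputable section Complex

variable {k G : Type u} [CommRing k] [Group G] [TopologicalSpace G] [IsTopologicalGroup G]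
  {V : Rep.{u} k G} (hV : IsSmooth V)

/-- The differential on continuous inhomogeneous cochains: the restriction of the usual one. -/
def contD (n : ℕ) :
    ModuleCat.of k (contCochain V n) ⟶ ModuleCat.of k (contCochain V (n + 1)) :=
  ModuleCat.ofHom
    ((inhomogeneousCochains.d V n).hom.restrict fun _ hf => d_mem_contCochain hV n hf)

theorem contD_comp_contD (n : ℕ) : contD hV n ≫ contD hV (n + 1) = 0 := by
  refine ModuleCat.hom_ext (LinearMap.ext fun f => Subtype.ext ?_)
  exact LinearMap.congr_fun
    (congrArg ModuleCat.Hom.hom (groupCohomology.inhomogeneousCochains.d_comp_d n V)) f.1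

/-- The complex `0 → C(G ^ 0, V) → C(G ^ 1, V) → C(G ^ 2, V) → ⋯` of continuous inhomogeneous
cochains with values in the smooth representation `V`, which carries the discrete topology. -/
def contCochains : CochainComplex (ModuleCat k) ℕ :=
  CochainComplex.of (fun n => ModuleCat.of k (contCochain V n)) (contD hV) (contD_comp_contD hV)

/-- The `q`-th continuous cohomology `H^q_cont(G, V)` of a smooth representation `V`. -/
def contCohomology (q : ℕ) : ModuleCat k := (contCochains hV).homology q

/-- The inclusion of the complex of continuous cochains into the complex of all cochains. -/
def contCochainsInclusion : contCochains hV ⟶ groupCohomology.inhomogeneousCochains V :=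
  CochainComplex.ofHom (fun n => ModuleCat.ofHom (contCochain V n).subtype) (fun n => by
    simp only [contCochains, CochainComplex.of_d]
    rfl)

/-- The comparison map `H^q_cont(G, V) → H^q_abs(G, V)`, where the target is the cohomology of `G`
as an abstract group. -/
def comparison (q : ℕ) : contCohomology hV q ⟶ groupCohomology V q :=
  HomologicalComplex.homologyMap (contCochainsInclusion hV) q

end Complex

end SmoothRep

/-!
If the closure of the powers of `x` is compact, then a cocycle `χ` with values killed by `m > 0`
vanishes on the closure of the powers of some `x ^ n` with `n > 0`: smoothness makes a power of `x`
fix `χ x`, so that a further power `y` is a zero of `χ`; the closure of the powers of `y` fixes the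
values of `χ` on itself because it is commutative, so `χ` is additive there and vanishes on `m`-th
powers.

In a small chart around `1`, the multiplication of `G` is the addition of `ℚ_[p] ^ d` up to a small
relative error. Successive approximation then shows that the products `x 1 ^ a 1 ⋯ x d ^ a d` are
dense near `1` when the coordinates of the `x i` are proportional to the standard basis, even with
all `a i` restricted to the multiples of a fixed positive integer. Since a product of `d` compact
sets is closed, the zero set of `χ` is a neighbourhood of `1`, which makes `χ` locally constant.
-/

namespace SmoothRep

open Filter Topology groupCohomology

section Cocycles

variable {k G : Type u} [CommRing k] [Group G] {V : Rep.{u} k G} (χ : cocycles₁ V)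

/-- The zero set of a `1`-cocycle, which is a subgroup. -/
def cocycleKer : Subgroup G where
  carrier := {g | χ g = 0}
  mul_mem' {a b} (ha : χ a = 0) (hb : χ b = 0) :=
    show χ (a * b) = 0 by rw [(mem_cocycles₁_iff χ).1 χ.2, ha, hb, map_zero, add_zero]
  one_mem' := cocycles₁_map_one χ
  inv_mem' {a} (ha : χ a = 0) := show χ a⁻¹ = 0 by
    rw [← V.ρ.inv_self_apply a (χ a⁻¹), cocycles₁_map_inv, ha, neg_zero, map_zero]

variable {χ}

theorem mem_cocycleKer {g : G} : g ∈ cocycleKer χ ↔ χ g = 0 := Iff.rfl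

theorem cocycle_map_pow_of_fixed {g : G} (hg : V.ρ g (χ g) = χ g) (n : ℕ) :
    χ (g ^ n) = n • χ g := by
  induction n with
  | zero => simp only [pow_zero, cocycles₁_map_one, zero_smul]
  | succ n ih => rw [pow_succ', (mem_cocycles₁_iff χ).1 χ.2, ih, map_nsmul, hg, succ_nsmul]

theorem fixes_cocycle_comm {a b : G} (hab : Commute a b) :
    V.ρ a (χ b) = χ b ↔ V.ρ b (χ a) = χ a := by
  have h : V.ρ a (χ b) + χ a = V.ρ b (χ a) + χ b := by
    rw [← (mem_cocycles₁_iff χ).1 χ.2, hab.eq, (mem_cocycles₁_iff χ).1 χ.2]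
  constructor <;> intro h'
  · rw [h', add_comm] at h
    exact (add_right_cancel h).symm
  · rw [h', add_comm (χ a)] at h
    exact add_right_cancel h

theorem isCont_iff_isLocallyConstant {X : Type u} [TopologicalSpace X] {f : X → V} :
    IsCont V f ↔ IsLocallyConstant f := by
  let _ : TopologicalSpace V := ⊥
  have : DiscreteTopology V := ⟨rfl⟩
  exact (IsLocallyConstant.iff_continuous f).symm

variable [TopologicalSpace G]

theorem isCont_of_cocycleKer_mem_nhds [SeparatelyContinuousMul G]
    (h : (cocycleKer χ : Set G) ∈ 𝓝 1) : IsCont V (fun g : G => χ g) := by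
  refine isCont_iff_isLocallyConstant.2 ((IsLocallyConstant.iff_eventually_eq _).2 fun g => ?_)
  have hlim : Tendsto (fun y => g⁻¹ * y) (𝓝 g) (𝓝 1) := by
    simpa only [inv_mul_cancel] using (continuous_const_mul g⁻¹).tendsto g
  filter_upwards [hlim h] with y hy
  have hχ := (mem_cocycles₁_iff χ).1 χ.2 g (g⁻¹ * y)
  rwa [mem_cocycleKer.1 hy, mul_inv_cancel_left, map_zero, zero_add] at hχ

theorem IsSmooth.isLocallyConstant_orbit (hV : IsSmooth V) (v : V) :
    IsLocallyConstant fun g : G => V.ρ g v := by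
  let _ : TopologicalSpace V := ⊥
  have hact : Continuous fun x : G × V => V.ρ x.1 x.2 := hV
  exact isCont_iff_isLocallyConstant.1 (hact.comp (Continuous.prodMk_left v))

theorem IsSmooth.finite_image_orbit (hV : IsSmooth V) {s : Set G} (hs : IsCompact s) (v : V) :
    ((fun g : G => V.ρ g v) '' s).Finite := by
  let _ : TopologicalSpace V := ⊥
  have : DiscreteTopology V := ⟨rfl⟩
  exact (hs.image (hV.isLocallyConstant_orbit v).continuous).finite_of_discrete

theorem IsSmooth.exists_pow_fixing (hV : IsSmooth V) {x : G}
    (hx : IsCompact (closure (Submonoid.powers x : Set G))) (v : V) :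
    ∃ n : ℕ, 0 < n ∧ V.ρ (x ^ n) v = v := by
  obtain ⟨a, b, hab, h⟩ : ∃ a b : ℕ, a < b ∧ V.ρ (x ^ a) v = V.ρ (x ^ b) v :=
    Set.Finite.exists_lt_map_eq_of_forall_mem
      (fun n => Set.mem_image_of_mem _
        (subset_closure (Submonoid.pow_mem _ (Submonoid.mem_powers x) n)))
      (hV.finite_image_orbit hx v)
  refine ⟨b - a, Nat.sub_pos_of_lt hab, (V.ρ.apply_bijective (x ^ a)).injective ?_⟩
  rw [← Module.End.mul_apply, ← map_mul, ← pow_add, Nat.add_sub_cancel' hab.le, h]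

theorem exists_pow_mem_cocycleKer (hV : IsSmooth V) {m : ℕ} (hm : 0 < m)
    (hχ : ∀ g, m • χ g = 0) {x : G} (hx : IsCompact (closure (Submonoid.powers x : Set G))) :
    ∃ n : ℕ, 0 < n ∧ x ^ n ∈ cocycleKer χ := by
  obtain ⟨n, hn, hfix⟩ := hV.exists_pow_fixing hx (χ x)
  have hx_fix : V.ρ x (χ (x ^ n)) = χ (x ^ n) :=
    (fixes_cocycle_comm (Commute.self_pow x n)).2 hfix
  have hpow_fix : ∀ j : ℕ, V.ρ (x ^ j) (χ (x ^ n)) = χ (x ^ n) := fun j => by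
    rw [map_pow, Module.End.pow_apply]
    exact Function.iterate_fixed hx_fix j
  refine ⟨n * m, Nat.mul_pos hn hm, ?_⟩
  rw [mem_cocycleKer, pow_mul, cocycle_map_pow_of_fixed (hpow_fix n), hχ]

theorem fixes_cocycle_of_mem_closure_powers [T2Space G] [ContinuousMul G] (hV : IsSmooth V)
    {y : G} (hy : y ∈ cocycleKer χ) {a b : G} (ha : a ∈ closure (Submonoid.powers y : Set G))
    (hb : b ∈ closure (Submonoid.powers y : Set G)) : V.ρ a (χ b) = χ b := by
  have hcomm : ∀ j : ℕ, Commute (y ^ j) b := fun j => by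
    have hclosed : IsClosed {g : G | y ^ j * g = g * y ^ j} :=
      isClosed_eq (by fun_prop) (by fun_prop)
    refine closure_minimal ?_ hclosed hb
    rintro _ ⟨l, rfl⟩
    exact Commute.pow_pow_self y j l
  refine closure_minimal ?_
    ((hV.isLocallyConstant_orbit (χ b)).isClosed_fiber (χ b)) ha
  rintro _ ⟨j, rfl⟩
  have hyj : χ (y ^ j) = 0 := (cocycleKer χ).pow_mem hy j
  refine (fixes_cocycle_comm (hcomm j)).2 ?_
  rw [hyj, map_zero]

theorem exists_closure_powers_subset_cocycleKer [T2Space G] [ContinuousMul G] (hV : IsSmooth V)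
    {m : ℕ} (hm : 0 < m) (hχ : ∀ g, m • χ g = 0) {x : G}
    (hx : IsCompact (closure (Submonoid.powers x : Set G))) :
    ∃ n : ℕ, 0 < n ∧ closure (Submonoid.powers (x ^ n) : Set G) ⊆ cocycleKer χ := by
  obtain ⟨n, hn, hxn⟩ := exists_pow_mem_cocycleKer hV hm hχ hx
  have hcompact : IsCompact (closure (Submonoid.powers (x ^ n) : Set G)) :=
    hx.of_isClosed_subset isClosed_closure
      (closure_mono (Submonoid.powers_le.2 (Submonoid.pow_mem _ (Submonoid.mem_powers x) n)))
  have himage :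
      (· ^ m) '' (Submonoid.powers (x ^ n) : Set G) = Submonoid.powers (x ^ (n * m)) := by
    simp only [Submonoid.coe_powers, ← Set.range_comp, Function.comp_def, ← pow_mul,
      mul_assoc, mul_comm m]
  refine ⟨n * m, Nat.mul_pos hn hm, ?_⟩
  rw [← himage, ← image_closure_of_isCompact hcompact (continuous_pow m).continuousOn]
  rintro _ ⟨b, hb, rfl⟩
  change χ (b ^ m) = 0
  rw [cocycle_map_pow_of_fixed (fixes_cocycle_of_mem_closure_powers hV hxn hb hb), hχ]

end Cocycles

section Comparison

open CategoryTheory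

variable {k G : Type u} [CommRing k] [Group G] {V : Rep.{u} k G}

theorem mem_cocycles₁_of_d_eq_zero {f : (Fin 1 → G) → V}
    (hf : (inhomogeneousCochains.d V 1).hom f = 0) :
    (fun g : G => f fun _ => g) ∈ cocycles₁ V := by
  refine (mem_cocycles₁_def _).2 fun a b => ?_
  have hab := (congrFun hf ![a, b]).trans (Pi.zero_apply _)
  rw [inhomogeneousCochains.d_hom_apply, Fin.sum_univ_two] at hab
  have hconst : ∀ g : Fin 1 → G, f g = f fun _ => g 0 := fun g =>
    congrArg f (funext fun i => by rw [Subsingleton.elim i 0])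
  rw [hconst, hconst (Fin.contractNth 0 _ _), hconst (Fin.contractNth 1 _ _)] at hab
  rw [sub_eq_add_neg, add_assoc]
  simpa [Fin.contractNth] using hab

variable [TopologicalSpace G]

theorem mem_contCochain_zero (f : (Fin 0 → G) → V) : f ∈ contCochain V 0 :=
  isCont_iff_isLocallyConstant.2 (IsLocallyConstant.of_constant f fun x y =>
    congrArg f (Subsingleton.elim x y))

theorem mem_contCochain_one_of_d_eq_zero (h : ∀ χ : cocycles₁ V, IsCont V (fun g : G => χ g))
    {f : (Fin 1 → G) → V} (hf : (inhomogeneousCochains.d V 1).hom f = 0) :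
    f ∈ contCochain V 1 := by
  have hloc : IsLocallyConstant fun g : G => f fun _ => g :=
    isCont_iff_isLocallyConstant.1 (h ⟨_, mem_cocycles₁_of_d_eq_zero hf⟩)
  have hcomp : f = (fun g : G => f fun _ => g) ∘ fun x => x 0 :=
    funext fun x => congrArg f (funext fun i => by rw [Subsingleton.elim i 0])
  exact isCont_iff_isLocallyConstant.2 (hcomp ▸ hloc.comp_continuous (continuous_apply 0))

variable [IsTopologicalGroup G] (hV : IsSmooth V)

instance mono_contCochainsInclusion_f (n : ℕ) : Mono ((contCochainsInclusion hV).f n) :=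
  (ModuleCat.mono_iff_injective _).2 Subtype.val_injective

theorem mono_comparison_succ (n : ℕ) (h : ∀ f : (Fin n → G) → V, f ∈ contCochain V n) :
    Mono (comparison hV (n + 1)) := by
  have : Epi ((contCochainsInclusion hV).f n) :=
    (ModuleCat.epi_iff_surjective _).2 fun f => ⟨(⟨f, h f⟩ : contCochain V n), rfl⟩
  have : IsIso ((contCochainsInclusion hV).f n) := isIso_of_mono_of_epi _
  refine (HomologicalComplex.mono_homologyMap_iff_up_to_refinements _ n (n + 1) (n + 2)
    (by simp) (by simp)).2 fun A x₂ _ y₁ hy =>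
      ⟨A, 𝟙 A, inferInstance, y₁ ≫ inv ((contCochainsInclusion hV).f n), ?_⟩
  rw [← cancel_mono ((contCochainsInclusion hV).f (n + 1)), Category.id_comp, hy,
    Category.assoc, Category.assoc, ← HomologicalComplex.Hom.comm, IsIso.inv_hom_id_assoc]

theorem epi_comparison (n : ℕ)
    (h : ∀ f, (inhomogeneousCochains.d V n).hom f = 0 → f ∈ contCochain V n) :
    Epi (comparison hV n) := by
  refine (HomologicalComplex.epi_homologyMap_iff_up_to_refinements _ _ n (n + 1)
    rfl (by simp)).2 fun A y hy => ?_
  have hmem : ∀ a : A, y.hom a ∈ contCochain V n := fun a => h _ <| by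
    rw [inhomogeneousCochains.d_def] at hy
    exact LinearMap.congr_fun (congrArg ModuleCat.Hom.hom hy) a
  let x : A ⟶ (contCochains hV).X n := ModuleCat.ofHom (y.hom.codRestrict _ hmem)
  have hxy : x ≫ (contCochainsInclusion hV).f n = y := rfl
  refine ⟨A, 𝟙 A, inferInstance, x, ?_, 0, by
    rw [Category.id_comp, hxy, Limits.zero_comp, add_zero]⟩
  rw [← cancel_mono ((contCochainsInclusion hV).f (n + 1)), Category.assoc,
    ← HomologicalComplex.Hom.comm, ← Category.assoc, hxy, hy, Limits.zero_comp]

theorem isIso_comparison_one (h : ∀ χ : cocycles₁ V, IsCont V (fun g : G => χ g)) :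
    IsIso (comparison hV 1) := by
  have : Mono (comparison hV 1) := mono_comparison_succ hV 0 mem_contCochain_zero
  have : Epi (comparison hV 1) := epi_comparison hV 1 fun _ => mem_contCochain_one_of_d_eq_zero h
  exact isIso_of_mono_of_epi _

end Comparison

end SmoothRep

open Filter Topology Metric

theorem norm_le_of_add_eq {E : Type*} [SeminormedAddCommGroup E] [IsUltrametricDist E]
    {x y z : E} {s : ℝ} (hx : ‖x‖ ≤ s) (hy : ‖y‖ ≤ s) (h : x + y = z) : ‖z‖ ≤ s :=
  h ▸ (IsUltrametricDist.norm_add_le_max x y).trans (max_le hx hy)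

theorem norm_le_of_norm_sub_le_mul {E : Type*} [SeminormedAddCommGroup E] [IsUltrametricDist E]
    {x y : E} {c s : ℝ} (hc : c ≤ 1) (h : ‖x - y‖ ≤ c * s) (hy : ‖y‖ ≤ s) : ‖x‖ ≤ s :=
  norm_le_of_add_eq (h.trans (mul_le_of_le_one_left ((norm_nonneg y).trans hy) hc)) hy
    (sub_add_cancel x y)

theorem norm_list_sum_le_of_forall_le {E : Type*} [SeminormedAddCommGroup E] [IsUltrametricDist E]
    {l : List E} {s : ℝ} (hs : 0 ≤ s) (h : ∀ x ∈ l, ‖x‖ ≤ s) : ‖l.sum‖ ≤ s := by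
  induction l with
  | nil => simpa only [List.sum_nil, norm_zero] using hs
  | cons x l ih =>
    rw [List.forall_mem_cons] at h
    exact norm_le_of_add_eq h.1 (ih h.2) List.sum_cons.symm

section OrderedProducts

variable {G ι : Type*} [Monoid G]

/-- The product of the powers `x i ^ a i`, taken in the order in which the indices occur in `l`:
these products replace coordinates of the second kind on `G`. -/
def powProd (x : ι → G) (l : List ι) (a : ι → ℕ) : G :=
  (l.map fun i => x i ^ a i).prod

theorem powProd_cons (x : ι → G) (i : ι) (l : List ι) (a : ι → ℕ) :
    powProd x (i :: l) a = x i ^ a i * powProd x l a :=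
  List.prod_cons

theorem powProd_zero (x : ι → G) (l : List ι) : powProd x l 0 = 1 :=
  List.prod_eq_one fun y hy => by
    obtain ⟨i, -, rfl⟩ := List.mem_map.1 hy
    exact pow_zero _

theorem powProd_nsmul (x : ι → G) (l : List ι) (n : ℕ) (a : ι → ℕ) :
    powProd x l (n • a) = powProd (fun i => x i ^ n) l a := by
  simp only [powProd, Pi.smul_apply, smul_eq_mul, pow_mul]

theorem powProd_mem {x : ι → G} {K : Submonoid G} (hx : ∀ i, x i ∈ K) (l : List ι) (a : ι → ℕ) :
    powProd x l a ∈ K :=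
  K.list_prod_mem fun y hy => by
    obtain ⟨i, -, rfl⟩ := List.mem_map.1 hy
    exact K.pow_mem (hx i) _

theorem closure_range_powProd_subset [TopologicalSpace G] [T2Space G] [ContinuousMul G]
    {x : ι → G} {K : Submonoid G}
    (hcompact : ∀ i, IsCompact (closure (Submonoid.powers (x i) : Set G)))
    (hK : ∀ i, closure (Submonoid.powers (x i) : Set G) ⊆ K) (l : List ι) :
    closure (Set.range (powProd x l)) ⊆ K := by
  obtain ⟨C, hC, hCK, hmem⟩ : ∃ C : Set G, IsCompact C ∧ C ⊆ K ∧ ∀ a, powProd x l a ∈ C := by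
    induction l with
    | nil => exact ⟨{1}, isCompact_singleton, Set.singleton_subset_iff.2 K.one_mem, fun _ => rfl⟩
    | cons i l ih =>
      obtain ⟨C, hC, hCK, hmem⟩ := ih
      refine ⟨_, ((hcompact i).prod hC).image continuous_mul, ?_, fun a => ?_⟩
      · rintro _ ⟨⟨g, h⟩, ⟨hg, hh⟩, rfl⟩
        exact K.mul_mem (hK i hg) (hCK hh)
      · rw [powProd_cons]
        exact ⟨(_, _), ⟨subset_closure ⟨a i, rfl⟩, hmem a⟩, rfl⟩
  exact (closure_minimal (Set.range_subset_iff.2 hmem) hC.isClosed).trans hCK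

end OrderedProducts

section SuccessiveApproximation

variable {p : ℕ} [Fact p.Prime] {ι : Type*} [Fintype ι]

theorem exists_natCast_norm_sub_le {t : ι → ℚ_[p]} (ht : ‖t‖ ≤ 1) {s : ℝ} (hs : 0 < s) :
    ∃ b : ι → ℕ, ‖t - fun i => (b i : ℚ_[p])‖ ≤ s := by
  have hcoord (i : ι) : ∃ n : ℕ, ‖t i - n‖ ≤ s := by
    let u : ℤ_[p] := ⟨t i, (norm_le_pi_norm t i).trans ht⟩
    obtain ⟨n, hn⟩ := PadicInt.denseRange_natCast.exists_dist_lt u hs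
    rw [dist_eq_norm, PadicInt.norm_def, PadicInt.coe_sub, PadicInt.coe_natCast] at hn
    exact ⟨n, hn.le⟩
  choose b hb using hcoord
  exact ⟨b, (pi_norm_le_iff_of_nonneg hs.le).2 hb⟩

variable {f : (ι → ℕ) → ι → ℚ_[p]} {π : ℚ_[p]}

theorem exists_norm_sub_le_pow_mul (hπ : π ≠ 0) (hf₀ : f 0 = 0)
    (hf : ∀ a b : ι → ℕ, ‖f (a + b) - f a - π • fun i => (b i : ℚ_[p])‖ ≤
      ‖(p : ℚ_[p])‖ * ‖π • fun i => (b i : ℚ_[p])‖)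
    {y : ι → ℚ_[p]} (hy : ‖y‖ ≤ ‖π‖) (n : ℕ) :
    ∃ a : ι → ℕ, ‖y - f a‖ ≤ ‖(p : ℚ_[p])‖ ^ n * ‖π‖ := by
  have hp₀ : 0 < ‖(p : ℚ_[p])‖ := norm_pos_iff.2 (Nat.cast_ne_zero.2 (Fact.out : p.Prime).ne_zero)
  have hp₁ : ‖(p : ℚ_[p])‖ ≤ 1 := Padic.norm_p_lt_one.le
  induction n with
  | zero => exact ⟨0, by rwa [hf₀, sub_zero, pow_zero, one_mul]⟩
  | succ n ih =>
    obtain ⟨a, ha⟩ := ih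
    have ht : ‖π⁻¹ • (y - f a)‖ ≤ ‖(p : ℚ_[p])‖ ^ n := by
      rwa [norm_smul, norm_inv, inv_mul_le_iff₀ (norm_pos_iff.2 hπ), mul_comm]
    obtain ⟨b, hb⟩ := exists_natCast_norm_sub_le (ht.trans (pow_le_one₀ hp₀.le hp₁))
      (pow_pos hp₀ (n + 1))
    set β : ι → ℚ_[p] := fun i => (b i : ℚ_[p])
    have hβ : ‖β‖ ≤ ‖(p : ℚ_[p])‖ ^ n := by
      rw [norm_sub_rev] at hb
      exact norm_le_of_add_eq (hb.trans (pow_le_pow_of_le_one hp₀.le hp₁ n.le_succ)) ht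
        (sub_add_cancel β _)
    have hlinear : ‖y - f a - π • β‖ ≤ ‖(p : ℚ_[p])‖ ^ (n + 1) * ‖π‖ := by
      have : y - f a - π • β = π • (π⁻¹ • (y - f a) - β) := by
        rw [smul_sub, smul_inv_smul₀ hπ]
      rw [this, norm_smul, mul_comm]
      gcongr
    have herror : ‖-(f (a + b) - f a - π • β)‖ ≤ ‖(p : ℚ_[p])‖ ^ (n + 1) * ‖π‖ := by
      rw [norm_neg]
      calc ‖f (a + b) - f a - π • β‖ ≤ ‖(p : ℚ_[p])‖ * ‖π • β‖ := hf a b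
        _ ≤ ‖(p : ℚ_[p])‖ * (‖π‖ * ‖(p : ℚ_[p])‖ ^ n) := by rw [norm_smul]; gcongr
        _ = ‖(p : ℚ_[p])‖ ^ (n + 1) * ‖π‖ := by ring
    exact ⟨a + b, norm_le_of_add_eq hlinear herror (by abel)⟩

theorem mem_closure_range_of_approx_additive (hπ : π ≠ 0) (hf₀ : f 0 = 0)
    (hf : ∀ a b : ι → ℕ, ‖f (a + b) - f a - π • fun i => (b i : ℚ_[p])‖ ≤
      ‖(p : ℚ_[p])‖ * ‖π • fun i => (b i : ℚ_[p])‖)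
    {y : ι → ℚ_[p]} (hy : ‖y‖ ≤ ‖π‖) : y ∈ closure (Set.range f) := by
  choose a ha using exists_norm_sub_le_pow_mul hπ hf₀ hf hy
  have hbound : Tendsto (fun n => ‖(p : ℚ_[p])‖ ^ n * ‖π‖) atTop (𝓝 0) := by
    simpa only [zero_mul] using (tendsto_pow_atTop_nhds_zero_of_lt_one (norm_nonneg _)
      Padic.norm_p_lt_one).mul_const ‖π‖
  have hlim : Tendsto (fun n => f (a n)) atTop (𝓝 y) :=
    tendsto_iff_norm_sub_tendsto_zero.2 (squeeze_zero (fun _ => norm_nonneg _)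
      (fun n => (norm_sub_rev _ _).trans_le (ha n)) hbound)
  exact mem_closure_of_tendsto hlim (.of_forall fun n => ⟨a n, rfl⟩)

end SuccessiveApproximation

/-- A chart `e` of `G` around `1`, with image a closed ball, in which the multiplication is the
addition of the coordinates up to a relative error of norm at most `‖p‖ ^ 2`. The exponent `2`
ensures that raising to the `p`-th power is still multiplication by `p` up to a small relative
error. -/
structure IsApproxAdditive (p : ℕ) [Fact p.Prime] {G E : Type*} [Monoid G] [TopologicalSpace G]
    [NormedAddCommGroup E] [NormedSpace ℚ_[p] E] (e : OpenPartialHomeomorph G E) : Prop where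
  one_mem : 1 ∈ e.source
  map_one : e 1 = 0
  exists_target_eq : ∃ r > 0, e.target = closedBall 0 r
  mul_mem : ∀ ⦃g⦄, g ∈ e.source → ∀ ⦃h⦄, h ∈ e.source → g * h ∈ e.source
  approximatesLinearOn : ApproximatesLinearOn (fun z : E × E => e (e.symm z.1 * e.symm z.2))
    (.fst ℚ_[p] E E + .snd ℚ_[p] E E) (e.target ×ˢ e.target) (‖(p : ℚ_[p])‖₊ ^ 2)

namespace IsApproxAdditive

variable {p : ℕ} [Fact p.Prime] {G E : Type*} [Monoid G] [TopologicalSpace G]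
  [NormedAddCommGroup E] [NormedSpace ℚ_[p] E] {e : OpenPartialHomeomorph G E}

/-- The domain of the chart, as a submonoid of `G`. -/
def submonoid (he : IsApproxAdditive p e) : Submonoid G where
  carrier := e.source
  one_mem' := he.one_mem
  mul_mem' hg hh := he.mul_mem hg hh

theorem pow_mem (he : IsApproxAdditive p e) {g : G} (hg : g ∈ e.source) (n : ℕ) :
    g ^ n ∈ e.source :=
  he.submonoid.pow_mem hg n

theorem powProd_mem (he : IsApproxAdditive p e) {ι : Type*} {x : ι → G}
    (hx : ∀ i, x i ∈ e.source) (l : List ι) (a : ι → ℕ) : powProd x l a ∈ e.source :=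
  _root_.powProd_mem (K := he.submonoid) hx l a

theorem norm_mul_sub_mul_sub_le (he : IsApproxAdditive p e) {g h g' h' : G} (hg : g ∈ e.source)
    (hh : h ∈ e.source) (hg' : g' ∈ e.source) (hh' : h' ∈ e.source) :
    ‖e (g * h) - e (g' * h') - ((e g - e g') + (e h - e h'))‖ ≤
      ‖(p : ℚ_[p])‖ ^ 2 * max ‖e g - e g'‖ ‖e h - e h'‖ := by
  have := he.approximatesLinearOn _ (Set.mk_mem_prod (e.map_source hg) (e.map_source hh))
    _ (Set.mk_mem_prod (e.map_source hg') (e.map_source hh'))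
  simpa only [e.left_inv hg, e.left_inv hh, e.left_inv hg', e.left_inv hh', Prod.mk_sub_mk,
    Prod.norm_mk, add_apply, ContinuousLinearMap.coe_fst',
    ContinuousLinearMap.coe_snd', NNReal.coe_pow, coe_nnnorm] using this

theorem norm_mul_sub_le (he : IsApproxAdditive p e) {g h : G} (hg : g ∈ e.source)
    (hh : h ∈ e.source) : ‖e (g * h) - e g - e h‖ ≤ ‖(p : ℚ_[p])‖ ^ 2 * ‖e h‖ := by
  simpa only [mul_one, he.map_one, sub_self, zero_add, sub_zero, norm_zero,
    max_eq_right (norm_nonneg _)] using he.norm_mul_sub_mul_sub_le hg hh hg he.one_mem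

theorem isCompact_closure_powers [T2Space G] [ProperSpace E] (he : IsApproxAdditive p e) {g : G}
    (hg : g ∈ e.source) : IsCompact (closure (Submonoid.powers g : Set G)) := by
  obtain ⟨r, -, hr⟩ := he.exists_target_eq
  have hsource : IsCompact e.source := by
    rw [← e.symm_image_target_eq_source, hr]
    exact (isCompact_closedBall 0 r).image_of_continuousOn (hr ▸ e.continuousOn_symm)
  exact hsource.closure_of_subset (Submonoid.powers_le (P := he.submonoid).2 hg)

variable [IsUltrametricDist E]

theorem norm_pow_sub_smul_le_sq (he : IsApproxAdditive p e) {g : G} (hg : g ∈ e.source) (n : ℕ) :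
    ‖e (g ^ n) - (n : ℚ_[p]) • e g‖ ≤ ‖(p : ℚ_[p])‖ ^ 2 * ‖e g‖ := by
  induction n with
  | zero =>
    rw [pow_zero, he.map_one, Nat.cast_zero, zero_smul, sub_self, norm_zero]
    positivity
  | succ n ih =>
    refine norm_le_of_add_eq (he.norm_mul_sub_le (he.pow_mem hg n) hg) ih ?_
    rw [pow_succ, Nat.cast_succ, add_smul, one_smul]
    abel

theorem norm_pow_prime_sub_smul_le (he : IsApproxAdditive p e) {g : G} (hg : g ∈ e.source)
    {q : ℕ} (hq : q.Prime) :
    ‖e (g ^ q) - (q : ℚ_[p]) • e g‖ ≤ ‖(p : ℚ_[p])‖ * ‖(q : ℚ_[p]) • e g‖ := by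
  have hpq : ‖(p : ℚ_[p])‖ ≤ ‖(q : ℚ_[p])‖ := by
    rcases eq_or_ne p q with rfl | hne
    · exact le_rfl
    · rw [Padic.norm_natCast_eq_one_iff.2 ((Nat.coprime_primes Fact.out hq).2 hne)]
      exact Padic.norm_p_lt_one.le
  calc ‖e (g ^ q) - (q : ℚ_[p]) • e g‖ ≤ ‖(p : ℚ_[p])‖ ^ 2 * ‖e g‖ :=
        he.norm_pow_sub_smul_le_sq hg q
    _ = ‖(p : ℚ_[p])‖ * (‖(p : ℚ_[p])‖ * ‖e g‖) := by ring
    _ ≤ ‖(p : ℚ_[p])‖ * ‖(q : ℚ_[p]) • e g‖ := by rw [norm_smul]; gcongr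

theorem norm_pow_sub_smul_le (he : IsApproxAdditive p e) {g : G} (hg : g ∈ e.source) (n : ℕ) :
    ‖e (g ^ n) - (n : ℚ_[p]) • e g‖ ≤ ‖(p : ℚ_[p])‖ * ‖(n : ℚ_[p]) • e g‖ := by
  induction n using Nat.recOnMul generalizing g with
  | zero => simp only [pow_zero, he.map_one, Nat.cast_zero, zero_smul, sub_self, norm_zero,
      mul_zero, le_refl]
  | one =>
    rw [pow_one, Nat.cast_one, one_smul, sub_self, norm_zero]
    positivity
  | prime q hq => exact he.norm_pow_prime_sub_smul_le hg hq
  | mul a b iha ihb =>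
    have hga : ‖e (g ^ a)‖ ≤ ‖(a : ℚ_[p]) • e g‖ :=
      norm_le_of_norm_sub_le_mul Padic.norm_p_lt_one.le (iha hg) le_rfl
    have hmul : ‖((a * b : ℕ) : ℚ_[p]) • e g‖ = ‖(b : ℚ_[p])‖ * ‖(a : ℚ_[p]) • e g‖ := by
      rw [Nat.cast_mul, mul_comm, mul_smul, norm_smul]
    rw [pow_mul, hmul, mul_left_comm]
    refine norm_le_of_add_eq (x := e ((g ^ a) ^ b) - (b : ℚ_[p]) • e (g ^ a))
      (y := (b : ℚ_[p]) • (e (g ^ a) - (a : ℚ_[p]) • e g)) ?_ ?_ (by push_cast; module)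
    · refine (ihb (he.pow_mem hg a)).trans ?_
      rw [norm_smul, mul_left_comm]
      gcongr
    · rw [norm_smul]
      gcongr
      exact iha hg

theorem norm_pow_add_sub_le (he : IsApproxAdditive p e) {g : G} (hg : g ∈ e.source) (a b : ℕ) :
    ‖e (g ^ (a + b)) - e (g ^ a) - (b : ℚ_[p]) • e g‖ ≤ ‖(p : ℚ_[p])‖ * ‖(b : ℚ_[p]) • e g‖ := by
  have hb := he.norm_pow_sub_smul_le hg b
  have hgb : ‖e (g ^ b)‖ ≤ ‖(b : ℚ_[p]) • e g‖ :=
    norm_le_of_norm_sub_le_mul Padic.norm_p_lt_one.le hb le_rfl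
  have hmul : ‖e (g ^ a * g ^ b) - e (g ^ a) - e (g ^ b)‖ ≤
      ‖(p : ℚ_[p])‖ * ‖(b : ℚ_[p]) • e g‖ :=
    (he.norm_mul_sub_le (he.pow_mem hg a) (he.pow_mem hg b)).trans
      (mul_le_mul (pow_le_of_le_one (norm_nonneg _) Padic.norm_p_lt_one.le two_ne_zero) hgb
        (norm_nonneg _) (norm_nonneg _))
  rw [pow_add]
  exact norm_le_of_add_eq hmul hb (by abel)

variable {ι : Type*} {x : ι → G}

theorem norm_powProd_add_sub_le (he : IsApproxAdditive p e) (hx : ∀ i, x i ∈ e.source)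
    (a b : ι → ℕ) {s : ℝ} (hs : 0 ≤ s) (hb : ∀ i, ‖(b i : ℚ_[p]) • e (x i)‖ ≤ s) (l : List ι) :
    ‖e (powProd x l (a + b)) - e (powProd x l a) - (l.map fun i => (b i : ℚ_[p]) • e (x i)).sum‖ ≤
      ‖(p : ℚ_[p])‖ * s := by
  have hp : ‖(p : ℚ_[p])‖ ≤ 1 := Padic.norm_p_lt_one.le
  induction l with
  | nil =>
    simp only [powProd, List.map_nil, List.prod_nil, List.sum_nil, sub_self, norm_zero]
    positivity
  | cons i l ih =>
    have hpow : ‖e (x i ^ (a i + b i)) - e (x i ^ a i) - (b i : ℚ_[p]) • e (x i)‖ ≤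
        ‖(p : ℚ_[p])‖ * s :=
      (he.norm_pow_add_sub_le (hx i) (a i) (b i)).trans
        (mul_le_mul_of_nonneg_left (hb i) (norm_nonneg _))
    have hpow_le : ‖e (x i ^ (a i + b i)) - e (x i ^ a i)‖ ≤ s :=
      norm_le_of_norm_sub_le_mul hp hpow (hb i)
    have htail_le : ‖e (powProd x l (a + b)) - e (powProd x l a)‖ ≤ s := by
      refine norm_le_of_norm_sub_le_mul hp ih (norm_list_sum_le_of_forall_le hs fun y hy => ?_)
      obtain ⟨j, -, rfl⟩ := List.mem_map.1 hy
      exact hb j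
    have hmul := he.norm_mul_sub_mul_sub_le (he.pow_mem (hx i) (a i + b i))
      (he.powProd_mem hx l (a + b)) (he.pow_mem (hx i) (a i)) (he.powProd_mem hx l a)
    have hmul_le := hmul.trans (mul_le_mul
      (pow_le_of_le_one (norm_nonneg _) hp two_ne_zero) (max_le hpow_le htail_le)
      ((norm_nonneg _).trans (le_max_left _ _)) (norm_nonneg _))
    rw [powProd_cons, powProd_cons, List.map_cons, List.sum_cons]
    exact norm_le_of_add_eq hmul_le (norm_le_of_add_eq hpow ih rfl)
      (by rw [Pi.add_apply]; abel)

section Coordinates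

variable [Fintype ι] {e : OpenPartialHomeomorph G (ι → ℚ_[p])}

theorem exists_map_eq_single [DecidableEq ι] (he : IsApproxAdditive p e) :
    ∃ ϖ : ℚ_[p], ϖ ≠ 0 ∧ ∃ x : ι → G, ∀ i, x i ∈ e.source ∧ e (x i) = Pi.single i ϖ := by
  obtain ⟨r, hr, htarget⟩ := he.exists_target_eq
  obtain ⟨ϖ, hϖ, hϖr⟩ := NormedField.exists_norm_lt ℚ_[p] hr
  have hmem (i : ι) : Pi.single i ϖ ∈ e.target := by
    rw [htarget, mem_closedBall_zero_iff, Pi.norm_single]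
    exact hϖr.le
  exact ⟨ϖ, norm_pos_iff.1 hϖ, fun i => e.symm (Pi.single i ϖ),
    fun i => ⟨e.map_target (hmem i), e.right_inv (hmem i)⟩⟩

theorem mem_closure_range_powProd [DecidableEq ι] (he : IsApproxAdditive p e) {ϖ : ℚ_[p]}
    (hϖ : ϖ ≠ 0) (hx : ∀ i, x i ∈ e.source) (hxe : ∀ i, e (x i) = Pi.single i ϖ) {n : ℕ}
    (hn : n ≠ 0) {g : G} (hg : g ∈ e.source) (hgn : ‖e g‖ ≤ ‖n * ϖ‖) :
    g ∈ closure (Set.range (powProd (fun i => x i ^ n) Finset.univ.toList)) := by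
  have hsmul (b : ι → ℕ) (i : ι) : (((n • b) i : ℕ) : ℚ_[p]) • e (x i) =
      Pi.single i (((n * ϖ) • fun i => (b i : ℚ_[p])) i) := by
    rw [hxe, ← Pi.single_smul, Pi.smul_apply, Pi.smul_apply, smul_eq_mul, smul_eq_mul, smul_eq_mul]
    congr 1
    push_cast
    ring
  have hadd (a b : ι → ℕ) : ‖e (powProd x Finset.univ.toList (n • (a + b))) -
      e (powProd x Finset.univ.toList (n • a)) - (n * ϖ) • fun i => (b i : ℚ_[p])‖ ≤
        ‖(p : ℚ_[p])‖ * ‖(n * ϖ) • fun i => (b i : ℚ_[p])‖ := by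
    have := he.norm_powProd_add_sub_le hx (n • a) (n • b) (norm_nonneg _) (fun i => by
      rw [hsmul, Pi.norm_single]
      exact norm_le_pi_norm _ i) Finset.univ.toList
    simpa only [hsmul, Finset.sum_map_toList, Finset.univ_sum_single, ← smul_add] using this
  have hclosure : e g ∈ closure (Set.range fun a =>
      e (powProd x Finset.univ.toList (n • a))) :=
    mem_closure_range_of_approx_additive (mul_ne_zero (Nat.cast_ne_zero.2 hn) hϖ)
      (by rw [smul_zero, powProd_zero, he.map_one]) hadd hgn
  have := mem_closure_image (e.continuousAt_symm (e.map_source hg)) hclosure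
  simp only [← Set.range_comp, Function.comp_def, e.left_inv (he.powProd_mem hx _ _),
    e.left_inv hg] at this
  simpa only [powProd_nsmul] using this

theorem exists_forall_mem_nhds_one [T2Space G] [ContinuousMul G] (he : IsApproxAdditive p e) :
    ∃ x : ι → G, (∀ i, IsCompact (closure (Submonoid.powers (x i) : Set G))) ∧
      ∀ (n : ι → ℕ) (K : Submonoid G), (∀ i, 0 < n i) →
        (∀ i, closure (Submonoid.powers (x i ^ n i) : Set G) ⊆ K) → (K : Set G) ∈ 𝓝 1 := by
  classical
  obtain ⟨ϖ, hϖ, x, hx⟩ := he.exists_map_eq_single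
  refine ⟨x, fun i => he.isCompact_closure_powers (hx i).1, fun n K hn hK => ?_⟩
  set N := ∏ i, n i
  have hN : N ≠ 0 := Finset.prod_ne_zero_iff.2 fun i _ => (hn i).ne'
  have hpowers (i : ι) : Submonoid.powers (x i ^ N) ≤ Submonoid.powers (x i ^ n i) := by
    obtain ⟨l, hl⟩ : n i ∣ N := Finset.dvd_prod_of_mem n (Finset.mem_univ i)
    rw [Submonoid.powers_le, hl, pow_mul]
    exact ⟨l, rfl⟩
  have hball : closedBall (0 : ι → ℚ_[p]) ‖(N : ℚ_[p]) * ϖ‖ ∈ 𝓝 (e 1) := by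
    rw [he.map_one]
    exact closedBall_mem_nhds 0 (norm_pos_iff.2 (mul_ne_zero (Nat.cast_ne_zero.2 hN) hϖ))
  filter_upwards [e.open_source.mem_nhds he.one_mem,
    (e.continuousAt he.one_mem).preimage_mem_nhds hball] with g hg hgN
  refine closure_range_powProd_subset
    (fun i => he.isCompact_closure_powers (he.pow_mem (hx i).1 N))
    (fun i => (closure_mono (hpowers i)).trans (hK i)) _
    (he.mem_closure_range_powProd hϖ (fun i => (hx i).1) (fun i => (hx i).2) hN hg ?_)
  exact mem_closedBall_zero_iff.1 hgN

end Coordinates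

end IsApproxAdditive

section Chart

theorem eq_fst_add_snd_of_hasFDerivAt {𝕜 E : Type*} [NontriviallyNormedField 𝕜]
    [NormedAddCommGroup E] [NormedSpace 𝕜 E] {F : E × E → E} {L : E × E →L[𝕜] E} {a b : E}
    (hF : HasFDerivAt F L (a, b)) (hl : ∀ᶠ x in 𝓝 a, F (x, b) = x)
    (hr : ∀ᶠ y in 𝓝 b, F (a, y) = y) : L = .fst 𝕜 E E + .snd 𝕜 E E := by
  have hinl : L.comp (.inl 𝕜 E E) = .id 𝕜 E :=
    (hF.comp (f := fun x => (x, b)) a (hasFDerivAt_prodMk_left a b)).unique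
      ((hasFDerivAt_id a).congr_of_eventuallyEq hl)
  have hinr : L.comp (.inr 𝕜 E E) = .id 𝕜 E :=
    (hF.comp (f := fun y => (a, y)) b (hasFDerivAt_prodMk_right a b)).unique
      ((hasFDerivAt_id b).congr_of_eventuallyEq hr)
  refine ContinuousLinearMap.ext fun z => ?_
  rw [← L.comp_inl_add_comp_inr, hinl, hinr]
  rfl

variable {𝕜 G E : Type*} [NontriviallyNormedField 𝕜] [Monoid G] [TopologicalSpace G]
  [NormedAddCommGroup E] [NormedSpace 𝕜 E]

theorem hasStrictFDerivAt_mul_of_contDiffAt {e : OpenPartialHomeomorph G E} (h1 : 1 ∈ e.source)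
    (he : ContDiffAt 𝕜 ω (fun z : E × E => e (e.symm z.1 * e.symm z.2)) (e 1, e 1)) :
    HasStrictFDerivAt (fun z : E × E => e (e.symm z.1 * e.symm z.2))
      (.fst 𝕜 E E + .snd 𝕜 E E) (e 1, e 1) := by
  have hstrict := he.analyticAt.hasStrictFDerivAt
  have htarget : ∀ᶠ x in 𝓝 (e 1), x ∈ e.target := e.open_target.mem_nhds (e.map_source h1)
  rwa [eq_fst_add_snd_of_hasFDerivAt hstrict.hasFDerivAt] at hstrict
  · filter_upwards [htarget] with x hx
    rw [e.left_inv h1, mul_one, e.right_inv hx]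
  · filter_upwards [htarget] with x hx
    rw [e.left_inv h1, one_mul, e.right_inv hx]

theorem contDiffAt_chartAt_one_mul [ChartedSpace E G] [ContMDiffMul 𝓘(𝕜, E) ω G] :
    ContDiffAt 𝕜 ω (fun z : E × E =>
      chartAt E (1 : G) ((chartAt E (1 : G)).symm z.1 * (chartAt E (1 : G)).symm z.2))
      (chartAt E (1 : G) 1, chartAt E (1 : G) 1) := by
  have h := (contMDiffAt_iff.1 (contMDiff_mul 𝓘(𝕜, E) ω (G := G) (1, 1))).2
  rw [ModelWithCorners.range_eq_univ, contDiffWithinAt_univ] at h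
  simp only [mul_one] at h
  exact h

theorem exists_chart_hasStrictFDerivAt_mul [ChartedSpace E G] [ContMDiffMul 𝓘(𝕜, E) ω G] :
    ∃ e : OpenPartialHomeomorph G E, 1 ∈ e.source ∧ e 1 = 0 ∧
      HasStrictFDerivAt (fun z : E × E => e (e.symm z.1 * e.symm z.2))
        (.fst 𝕜 E E + .snd 𝕜 E E) 0 := by
  set c := chartAt E (1 : G)
  let e := c.transHomeomorph (Homeomorph.subRight (c 1))
  have h1 : 1 ∈ e.source := mem_chart_source E (1 : G)
  have he1 : e 1 = 0 := sub_self (c 1)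
  refine ⟨e, h1, he1, ?_⟩
  have hshift : ContDiffAt 𝕜 ω (fun z : E × E => (z.1 + c 1, z.2 + c 1)) (0, 0) := by fun_prop
  have hF : ContDiffAt 𝕜 ω (fun z : E × E => e (e.symm z.1 * e.symm z.2)) (0, 0) := by
    have := contDiffAt_chartAt_one_mul (𝕜 := 𝕜) (E := E) (G := G)
    rw [← zero_add (c 1)] at this
    exact (this.comp (0, 0) hshift).sub contDiffAt_const
  simpa only [he1, Prod.mk_zero_zero] using
    hasStrictFDerivAt_mul_of_contDiffAt h1 (he1.symm ▸ hF)

theorem t2Space_of_one_mem_source {G X : Type*} [Group G] [TopologicalSpace G]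
    [IsTopologicalGroup G] [TopologicalSpace X] [T1Space X] (e : OpenPartialHomeomorph G X)
    (h1 : 1 ∈ e.source) : T2Space G := by
  refine IsTopologicalGroup.t2Space_of_one_sep fun x hx => ?_
  by_cases hxe : x ∈ e.source
  · have hne : e 1 ≠ e x := fun h => hx (e.injOn h1 hxe h).symm
    exact ⟨e ⁻¹' {e x}ᶜ, (e.continuousAt h1).preimage_mem_nhds
      (isOpen_compl_singleton.mem_nhds hne), fun h => h rfl⟩
  · exact ⟨e.source, e.open_source.mem_nhds h1, hxe⟩

end Chart

section Existence

variable {G E : Type*} [Monoid G] [TopologicalSpace G] [ContinuousMul G] [NormedAddCommGroup E]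

theorem eventually_symm_mul_symm_mem_source (e : OpenPartialHomeomorph G E) (h1 : 1 ∈ e.source)
    (he1 : e 1 = 0) : ∀ᶠ z : E × E in 𝓝 0, e.symm z.1 * e.symm z.2 ∈ e.source := by
  have hsymm0 : e.symm 0 = 1 := he1 ▸ e.left_inv h1
  have hsymm : ContinuousAt e.symm 0 := he1 ▸ e.continuousAt_symm (e.map_source h1)
  have hcont : ContinuousAt (fun z : E × E => e.symm z.1 * e.symm z.2) 0 :=
    (ContinuousAt.comp (x := (0 : E × E)) (g := e.symm) hsymm continuousAt_fst).mul
      (ContinuousAt.comp (x := (0 : E × E)) (g := e.symm) hsymm continuousAt_snd)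
  refine hcont.preimage_mem_nhds (e.open_source.mem_nhds ?_)
  rwa [Prod.fst_zero, Prod.snd_zero, hsymm0, mul_one]

variable {p : ℕ} [Fact p.Prime] [NormedSpace ℚ_[p] E] [IsUltrametricDist E]

theorem exists_isApproxAdditive (e : OpenPartialHomeomorph G E) (h1 : 1 ∈ e.source)
    (he1 : e 1 = 0) (hmul : HasStrictFDerivAt (fun z : E × E => e (e.symm z.1 * e.symm z.2))
      (.fst ℚ_[p] E E + .snd ℚ_[p] E E) 0) :
    ∃ e' : OpenPartialHomeomorph G E, IsApproxAdditive p e' := by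
  have hp : 0 < ‖(p : ℚ_[p])‖₊ ^ 2 := pow_pos (nnnorm_pos.2 (Nat.cast_ne_zero.2
    (Fact.out : p.Prime).ne_zero)) 2
  obtain ⟨s, hs, happrox⟩ := hmul.approximates_deriv_on_nhds (.inr hp)
  have htarget : e.target ∈ 𝓝 (0 : E) := he1 ▸ e.open_target.mem_nhds (e.map_source h1)
  have hsymm0 : e.symm 0 = 1 := he1 ▸ e.left_inv h1
  obtain ⟨r, hr, hball⟩ := nhds_basis_closedBall.mem_iff.1
    (inter_mem (inter_mem hs (eventually_symm_mul_symm_mem_source e h1 he1))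
      (prod_mem_nhds htarget htarget))
  rw [← Prod.mk_zero_zero, ← closedBall_prod_same] at hball
  let e' := (e.symm.restrOpen (closedBall 0 r)
    (IsUltrametricDist.isOpen_closedBall 0 hr.ne')).symm
  have hmem0 : (0, 0) ∈ closedBall (0 : E) r ×ˢ closedBall (0 : E) r :=
    ⟨mem_closedBall_self hr.le, mem_closedBall_self hr.le⟩
  have hmul_mem {x y : E} (hx : x ∈ closedBall 0 r) (hy : y ∈ closedBall 0 r) :
      e (e.symm x * e.symm y) ∈ closedBall 0 r := by
    have hxy := happrox (x, y) (hball (Set.mk_mem_prod hx hy)).1.1 (0, 0) (hball hmem0).1.1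
    simp only [hsymm0, mul_one, he1, Prod.mk_zero_zero, sub_zero, add_apply,
      ContinuousLinearMap.coe_fst', ContinuousLinearMap.coe_snd', Prod.norm_mk, NNReal.coe_pow,
      coe_nnnorm] at hxy
    rw [mem_closedBall_zero_iff] at hx hy ⊢
    exact norm_le_of_norm_sub_le_mul (pow_le_one₀ (norm_nonneg _) Padic.norm_p_lt_one.le)
      (hxy.trans (mul_le_mul_of_nonneg_left (max_le hx hy) (by positivity)))
      (norm_le_of_add_eq hx hy rfl)
  have htarget' : e'.target = closedBall 0 r :=
    Set.inter_eq_right.2 fun x hx => (hball (Set.mk_mem_prod hx hx)).2.1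
  refine ⟨e', ⟨⟨h1, ?_⟩, he1, ⟨r, hr, htarget'⟩, ?_, ?_⟩⟩
  · exact (he1.symm ▸ mem_closedBall_self hr.le : e 1 ∈ closedBall 0 r)
  · rintro g ⟨hg, hgr⟩ h ⟨hh, hhr⟩
    have hsource : e.symm (e g) * e.symm (e h) ∈ e.source :=
      (hball (Set.mk_mem_prod hgr hhr)).1.2
    have hmem : e (e.symm (e g) * e.symm (e h)) ∈ closedBall 0 r := hmul_mem hgr hhr
    rw [e.left_inv hg, e.left_inv hh] at hsource hmem
    exact ⟨hsource, hmem⟩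
  · rw [htarget']
    exact happrox.mono_set fun z hz => (hball hz).1.1

end Existence

theorem IsPAdicAnalyticGroup.isCont_cocycle {p : ℕ} [Fact p.Prime] {k G : Type u} [CommRing k]
    [Group G] [TopologicalSpace G] [IsTopologicalGroup G] (hG : IsPAdicAnalyticGroup p G)
    {V : Rep.{u} k G} (hV : SmoothRep.IsSmooth V) {m : ℕ} (hm : 0 < m)
    {χ : groupCohomology.cocycles₁ V} (hχ : ∀ g, m • χ g = 0) :
    SmoothRep.IsCont V (fun g : G => χ g) := by
  obtain ⟨d, _, _⟩ := hG
  obtain ⟨e, h1, he1, hmul⟩ :=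
    exists_chart_hasStrictFDerivAt_mul (𝕜 := ℚ_[p]) (G := G) (E := Fin d → ℚ_[p])
  have : T2Space G := t2Space_of_one_mem_source e h1
  obtain ⟨e', he'⟩ := exists_isApproxAdditive e h1 he1 hmul
  obtain ⟨x, hx, hnhds⟩ := he'.exists_forall_mem_nhds_one
  choose n hn hnχ using fun i =>
    SmoothRep.exists_closure_powers_subset_cocycleKer hV hm hχ (hx i)
  exact SmoothRep.isCont_of_cocycleKer_mem_nhds
    (hnhds n (SmoothRep.cocycleKer χ).toSubmonoid hn hnχ)

theorem theorem1p2_general {p : ℕ} [Fact p.Prime] {G : Type u} [Group G] [TopologicalSpace G]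
    [IsTopologicalGroup G] (hG : IsPAdicAnalyticGroup p G) {k : Type u} [CommRing k] {m : ℕ}
    (hm : 0 < m) {V : Rep.{u} k G} (hmV : ∀ v : V, m • v = 0) (hV : SmoothRep.IsSmooth V) :
    (∀ χ : groupCohomology.cocycles₁ V, SmoothRep.IsCont V (fun g : G => χ g)) ∧
      CategoryTheory.IsIso (SmoothRep.comparison hV 1) :=
  have h : ∀ χ : groupCohomology.cocycles₁ V, SmoothRep.IsCont V (fun g : G => χ g) :=
    fun χ => hG.isCont_cocycle hV hm fun g => hmV (χ g)
  ⟨h, SmoothRep.isIso_comparison_one hV h⟩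

theorem theorem1p2 (p : ℕ) [Fact p.Prime]
    (G : Type u) [Group G] [TopologicalSpace G] [IsTopologicalGroup G] [CompactSpace G]
    (hG : IsPAdicAnalyticGroup p G)
    (k : Type u) [CommRing k] (m : ℕ) [CharP k m] (hm : 0 < m)
    (V : Rep.{u} k G) (hV : SmoothRep.IsSmooth V) :
    (∀ χ : groupCohomology.cocycles₁ V, SmoothRep.IsCont V (fun g : G => χ g)) ∧
      CategoryTheory.IsIso (SmoothRep.comparison hV 1) :=
  theorem1p2_general hG hm
    (fun v => by rw [← Nat.cast_smul_eq_nsmul k, CharP.cast_eq_zero, zero_smul]) hV
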